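/- Consider an infinite-horizon discounted dynamic program: $S\subseteq\mathbb R^n$ and $A\subseteq\mathbb R^k$ are Borel sets (of states and actions) with the componentwise order, $\Gamma$ assigns to each $s\in S$ a set $\Gamma(s)\subseteq A$ of feasible actions, $p(s,a,\cdot)$ is a (Borel) transition probability from $S\times A$ to $S$, $r:S\times A\to\mathbb R$ is a Borel measurable payoff and $\beta\in(0,1)$. A strategy $\sigma=(\sigma_t)_{t\ge1}$ consists of Borel maps $\sigma_t$ from the histories $(s(1),a(1),\dots,s(t))$ to $A$ with $\sigma_t(s(1),a(1),\dots,s(t))\in\Gamma(s(t))$. With the expectation $\mathbb E_\sigma$ taken under the law of the state-action process induced by $\sigma$, $p$ and the initial state $s(1)=s$, let $$V_\sigma(s)=\mathbb E_{\sigma}\sum_{t=1}^\infty\beta^{t-1}r(s(t),a(t)),\qquad V(s)=\sup_\sigma V_\sigma(s).$$ A strategy $\sigma$ is optimal if $V_\sigma(s)=V(s)$ for all $s\in S$. A policy function is a Borel map $\lambda:S\to A$ with $\lambda(s)\in\Gamma(s)$ for all $s$; it is optimal if the stationary strategy $\sigma_t(s(1),a(1),\dots,s(t))=\lambda(s(t))$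 is optimal. Assume that $r$ is bounded and upper semicontinuous (u.s.c.); that $(s,a)\mapsto\int f(s')\,p(s,a,ds')$ is bounded and u.s.c. for every bounded u.s.c. $f:S\to\mathbb R$; that $\Gamma(s)$ is nonempty and compact for every $s$; and that $\{s\in S:\Gamma(s)\subseteq U\}$ is open in $S$ for every $U$ open in $A$. A function $h$ of $(s,a)$ is called increasing in $s$ if $h(s_1,a)\le h(s_2,a)$ whenever $s_1\le s_2$ and $a\in\Gamma(s_1)\cap\Gamma(s_2)$. It is called concave if the concavity inequality holds on the graph $\{(s,a):a\in\Gamma(s)\}$, and strictly concave in $a$ if for each $s$ the strict concavity inequality holds for $h(s,\cdot)$ on $\Gamma(s)$. The transition probability $p$ is called increasing in $s$ (respectively concave) if $(s,a)\mapsto\int f(s')\,p(s,a,ds')$ is increasing in $s$ (respectively concave) for every bounded Borel measurable $f:S\to\mathbb R$ that is increasing (respectively concave). The correspondence $\Gamma$ is called convex if $a_1\in\Gamma(s_1)$, $a_2\in\Gamma(s_2)$, $\lambda\in(0,1)$ imply $\lambda a_1+(1-\lambda)a_2\in\Gamma(\lambda s_1+(1-\lambda)s_2)$. (1) (Monotonicity)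 If $r$ and $p$ are increasing in $s$ and $\Gamma(s_1)\subseteq\Gamma(s_2)$ whenever $s_1\le s_2$, then $V$ is increasing: $V(s_1)\le V(s_2)$ whenever $s_1\le s_2$. (2) (Concavity) If $p$ and $r$ are concave, $S$ is convex and $\Gamma$ is convex, then $V$ is concave. If in addition $r$ is strictly concave in $a$, then there is exactly one optimal policy function. -/

import Mathlib

open MeasureTheory ProbabilityTheory Set

/-- A function is bounded if its absolute value is bounded by a constant. -/
def BddFun {X : Type*} (f : X → ℝ) : Prop := ∃ M : ℝ, ∀ x, |f x| ≤ M

/-- `f : X → ℝ` is concave on `C ⊆ X`, where `X` is regarded as a subset of the real vector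
space `E` through the (injective) map `e`: the concavity inequality holds whenever the two points
and their convex combination belong to `C`. -/
def ConcaveWithin {X E : Type*} [AddCommMonoid E] [Module ℝ E]
    (e : X → E) (C : Set X) (f : X → ℝ) : Prop :=
  ∀ x ∈ C, ∀ y ∈ C, ∀ z ∈ C, ∀ t : ℝ, 0 < t → t < 1 →
    e z = t • e x + (1 - t) • e y → t * f x + (1 - t) * f y ≤ f z

/-- Strict concavity on `C ⊆ X`, with the same conventions as `ConcaveWithin`. -/
def StrictConcaveWithin {X E : Type*} [AddCommMonoid E] [Module ℝ E]
    (e : X → E) (C : Set X) (f : X → ℝ) : Prop :=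
  ∀ x ∈ C, ∀ y ∈ C, ∀ z ∈ C, x ≠ y → ∀ t : ℝ, 0 < t → t < 1 →
    e z = t • e x + (1 - t) • e y → t * f x + (1 - t) * f y < f z

/-- An infinite-horizon discounted dynamic program with state space `S ⊆ ℝⁿ` and action space
`A ⊆ ℝᵏ` (with their subspace topologies, Borel σ-algebras and product orders): a correspondence
`Γ` of feasible actions, a transition probability `p`, a one-period payoff `r` and a discount
factor `β`. -/
structure DynProg {n k : ℕ} (S : Set (Fin n → ℝ)) (A : Set (Fin k → ℝ)) where
  Γ : S → Set A
  p : Kernel (S × A) S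
  markov : IsMarkovKernel p
  r : S × A → ℝ
  measurable_r : Measurable r
  β : ℝ
  β_pos : 0 < β
  β_lt_one : β < 1

attribute [instance] DynProg.markov

namespace DynProg

variable {n k : ℕ} {S : Set (Fin n → ℝ)} {A : Set (Fin k → ℝ)}

/-- The history observed before the action at time `t` (with `t = 0, 1, 2, …`): the `t` past
state-action pairs and the current state. -/
abbrev Hist (S : Set (Fin n → ℝ)) (A : Set (Fin k → ℝ)) (t : ℕ) : Type := (Fin t → S × A) × S

/-- A strategy: Borel measurable maps from histories to actions that are feasible at the current
state. -/
structure Strategy (P : DynProg S A) where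
  act : (t : ℕ) → Hist S A t → A
  measurable_act : ∀ t, Measurable (act t)
  feasible : ∀ t (h : Hist S A t), act t h ∈ P.Γ h.2

/-- Regards the past pairs up to time `t`, together with the state at time `t + 1`, as a history. -/
def toHist (S : Set (Fin n → ℝ)) (A : Set (Fin k → ℝ)) (t : ℕ)
    (x : ((i : Finset.Iic t) → S × A) × S) : Hist S A (t + 1) :=
  (fun i => x.1 ⟨i, Finset.mem_Iic.2 (Nat.lt_succ_iff.1 i.2)⟩, x.2)

theorem measurable_toHist (S : Set (Fin n → ℝ)) (A : Set (Fin k → ℝ)) (t : ℕ) :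
    Measurable (toHist S A t) :=
  Measurable.prodMk
    (measurable_pi_lambda _ fun _ => (measurable_pi_apply _).comp measurable_fst) measurable_snd

/-- The conditional law of `(s(t+1), a(t+1))` given the pairs up to time `t`: the state
`s(t+1)` is drawn from `p(s(t), a(t), ·)`, and the action is the one the strategy prescribes. -/
noncomputable def stepKernel (P : DynProg S A) (σ : P.Strategy) (t : ℕ) :
    Kernel ((i : Finset.Iic t) → S × A) (S × A) :=
  (P.p.comap (fun x : (i : Finset.Iic t) → S × A => x ⟨t, Finset.mem_Iic.2 le_rfl⟩)
      (measurable_pi_apply _)) ⊗ₖ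
    (Kernel.deterministic (fun x => σ.act (t + 1) (toHist S A t x))
      ((σ.measurable_act (t + 1)).comp (measurable_toHist S A t)))

instance (P : DynProg S A) (σ : P.Strategy) (t : ℕ) : IsMarkovKernel (P.stepKernel σ t) := by
  unfold stepKernel
  infer_instance

/-- The law of the state-action process `(s(t), a(t))`, `t = 0, 1, 2, …`, under the strategy `σ`
when the initial state is `s` (the Ionescu-Tulcea extension of the step kernels). -/
noncomputable def law (P : DynProg S A) (σ : P.Strategy) (s : S) : Measure (ℕ → S × A) :=
  Kernel.traj (X := fun _ => S × A) (P.stepKernel σ) 0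
    (fun _ => (s, σ.act 0 (fun i => i.elim0, s)))

/-- The expected discounted payoff of the strategy `σ` from the initial state `s`. -/
noncomputable def payoff (P : DynProg S A) (σ : P.Strategy) (s : S) : ℝ :=
  ∫ ω, ∑' t : ℕ, P.β ^ t * P.r (ω t) ∂(P.law σ s)

/-- The value function: the supremum of the expected discounted payoff over all strategies. -/
noncomputable def value (P : DynProg S A) (s : S) : ℝ := ⨆ σ : P.Strategy, P.payoff σ s

/-- A stationary policy function: a Borel measurable feasible selection. -/
structure Policy (P : DynProg S A) where
  toFun : S → A
  measurable_toFun : Measurable toFun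
  feasible : ∀ s, toFun s ∈ P.Γ s

/-- The stationary strategy that follows a policy function at every date. -/
def Policy.toStrategy {P : DynProg S A} (l : P.Policy) : P.Strategy where
  act := fun _ h => l.toFun h.2
  measurable_act := fun _ => l.measurable_toFun.comp measurable_snd
  feasible := fun _ h => l.feasible h.2

/-- A strategy is optimal if it attains the value function at every initial state. -/
def Strategy.IsOptimal {P : DynProg S A} (σ : P.Strategy) : Prop :=
  ∀ s, P.payoff σ s = P.value s

/-- The standing upper semicontinuity assumptions. -/
structure UscAssumptions (P : DynProg S A) : Prop where
  bdd_r : BddFun P.r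
  usc_r : UpperSemicontinuous P.r
  usc_p : ∀ f : S → ℝ, UpperSemicontinuous f → BddFun f →
    UpperSemicontinuous (fun x : S × A => ∫ s', f s' ∂(P.p x)) ∧
      BddFun (fun x : S × A => ∫ s', f s' ∂(P.p x))
  usc_Γ : ∀ U : Set A, IsOpen U → IsOpen {s : S | P.Γ s ⊆ U}
  nonempty_Γ : ∀ s, (P.Γ s).Nonempty
  compact_Γ : ∀ s, IsCompact (P.Γ s)

/-- The graph of the correspondence of feasible actions. -/
def graph (P : DynProg S A) : Set (S × A) := {x | x.2 ∈ P.Γ x.1}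

/-- The function `h` of a state and an action is increasing in the state, among feasible pairs. -/
def IncreasingInState (P : DynProg S A) (h : S × A → ℝ) : Prop :=
  ∀ (s₁ s₂ : S) (a : A), s₁ ≤ s₂ → (s₁, a) ∈ P.graph → (s₂, a) ∈ P.graph →
    h (s₁, a) ≤ h (s₂, a)

/-- The function `h` of a state and an action is jointly concave on the feasible pairs. -/
def JointlyConcave (P : DynProg S A) (h : S × A → ℝ) : Prop :=
  ConcaveWithin (fun x : S × A => ((x.1 : Fin n → ℝ), (x.2 : Fin k → ℝ))) P.graph h

/-- The function `h` of a state and an action is strictly concave in the (feasible) action. -/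
def StrictConcaveInAction (P : DynProg S A) (h : S × A → ℝ) : Prop :=
  ∀ s : S, StrictConcaveWithin (fun a : A => (a : Fin k → ℝ)) (P.Γ s) (fun a => h (s, a))

/-- `p` is increasing in the state: `∫ f(s') p(s, a, ds')` is, whenever `f` is increasing. -/
def KernelIncreasingInState (P : DynProg S A) : Prop :=
  ∀ f : S → ℝ, Measurable f → BddFun f → Monotone f →
    P.IncreasingInState (fun x => ∫ s', f s' ∂(P.p x))

/-- The real function `f` on the state space is concave. -/
def ConcaveState (f : S → ℝ) : Prop :=
  ConcaveWithin (fun s : S => (s : Fin n → ℝ)) Set.univ f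

/-- `p` is concave: `∫ f(s') p(s, a, ds')` is concave in `(s, a)` whenever `f` is concave. -/
def KernelConcave (P : DynProg S A) : Prop :=
  ∀ f : S → ℝ, Measurable f → BddFun f → ConcaveState f →
    P.JointlyConcave (fun x => ∫ s', f s' ∂(P.p x))

/-- The correspondence of feasible actions is convex. -/
def ConvexCorrespondence (P : DynProg S A) : Prop :=
  ∀ (s₁ s₂ s : S) (a₁ a₂ : A) (t : ℝ), a₁ ∈ P.Γ s₁ → a₂ ∈ P.Γ s₂ → 0 < t → t < 1 →
    (s : Fin n → ℝ) = t • (s₁ : Fin n → ℝ) + (1 - t) • (s₂ : Fin n → ℝ) →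
    ∃ a ∈ P.Γ s, (a : Fin k → ℝ) = t • (a₁ : Fin k → ℝ) + (1 - t) • (a₂ : Fin k → ℝ)

end DynProg

/-! The Bellman operator sends bounded u.s.c. functions to bounded u.s.c. functions and contracts
the sup distance by `β`. Iterating it from `0` therefore converges uniformly to a bounded u.s.c.
fixed point `W`. The Bellman maximum is attained, and a measurable selection of maximizers is a
policy.

Verification identifies `W` with `P.value`: `W s` minus the payoff of a strategy is the telescoped
sum of discounted expected Bellman gaps (`hasSum_value_sub_payoff`). These gaps are nonnegative for
every strategy and vanish for the selected policy. Keeping only the gap at time `0` shows that an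
optimal policy maximizes at every state.

Monotonicity and concavity hold for `0`, are preserved by the operator, and survive pointwise
limits, so `W` inherits them. If `r` is strictly concave in the action, the midpoint of two distinct
maximizers would beat `W`; the maximizer, hence the optimal policy, is unique. -/

/-! ### Measurable selection -/

/-- A compact-valued correspondence whose lower inverses of closed sets are measurable. -/
structure IsMeasurableCompactValued {X Y : Type*} [MeasurableSpace X] [TopologicalSpace Y]
    (D : X → Set Y) : Prop where
  nonempty : ∀ x, (D x).Nonempty
  isCompact : ∀ x, IsCompact (D x)
  measurableSet : ∀ F : Set Y, IsClosed F → MeasurableSet {x | (D x ∩ F).Nonempty}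

theorem IsMeasurableCompactValued.argmin {X Y : Type*} [MeasurableSpace X] [TopologicalSpace Y]
    {D : X → Set Y} (hD : IsMeasurableCompactValued D) {g : Y → ℝ} (hg : Continuous g) :
    IsMeasurableCompactValued fun x => {a ∈ D x | ∀ b ∈ D x, g a ≤ g b} where
  nonempty x := by
    obtain ⟨a, ha, hm⟩ := (hD.isCompact x).exists_isMinOn (hD.nonempty x) hg.continuousOn
    exact ⟨a, ha, fun b hb => hm hb⟩
  isCompact x := by
    have hc : IsClosed {a | ∀ b ∈ D x, g a ≤ g b} := by
      simp only [ofPred_forall]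
      exact isClosed_biInter fun b _ => isClosed_le hg continuous_const
    exact (hD.isCompact x).inter_right hc
  measurableSet F hF := by
    have hle : ∀ q : ℚ, IsClosed {a | g a ≤ q} := fun q => isClosed_le hg continuous_const
    -- A minimizer lies in `F` iff the minimum over `D x ∩ F` is no larger than that over `D x`;
    -- testing rational levels makes this a countable condition.
    have key : {x | ({a ∈ D x | ∀ b ∈ D x, g a ≤ g b} ∩ F).Nonempty} =
        ⋂ q : ℚ, {x | (D x ∩ {a | g a ≤ q}).Nonempty}ᶜ ∪
          {x | (D x ∩ (F ∩ {a | g a ≤ q})).Nonempty} := by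
      ext x
      simp only [mem_ofPred_eq, mem_iInter, mem_union, mem_compl_iff]
      constructor
      · rintro ⟨a, ⟨ha, hmin⟩, haF⟩ q
        by_cases h : (D x ∩ {a | g a ≤ q}).Nonempty
        · obtain ⟨b, hb, hbq⟩ := h
          exact Or.inr ⟨a, ha, haF, (hmin b hb).trans hbq⟩
        · exact Or.inl h
      · intro H
        obtain ⟨b, hb, hm⟩ := (hD.isCompact x).exists_isMinOn (hD.nonempty x) hg.continuousOn
        have hq : ∀ q : ℚ, g b < q → (D x ∩ (F ∩ {a | g a ≤ q})).Nonempty := fun q hq =>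
          (H q).resolve_left fun h => h ⟨b, hb, hq.le⟩
        obtain ⟨q₀, hq₀⟩ := exists_rat_gt (g b)
        obtain ⟨c, hcD, hcF, -⟩ := hq q₀ hq₀
        obtain ⟨a, ha, ham⟩ := ((hD.isCompact x).inter_right hF).exists_isMinOn
          ⟨c, hcD, hcF⟩ hg.continuousOn
        refine ⟨a, ⟨ha.1, fun d hd => le_trans ?_ (hm hd)⟩, ha.2⟩
        by_contra! hlt
        obtain ⟨q, hq1, hq2⟩ := exists_rat_btwn hlt
        obtain ⟨d, hd, hdF, hdq⟩ := hq q hq1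
        have hle : g a ≤ g d := ham ⟨hd, hdF⟩
        have hdq' : g d ≤ q := hdq
        linarith
    rw [key]
    exact MeasurableSet.iInter fun q => (hD.measurableSet _ (hle q)).compl.union
      (hD.measurableSet _ (hF.inter (hle q)))

/-- Measurable selection, by lexicographic minimization of the coordinates. -/
theorem IsMeasurableCompactValued.exists_measurable_selection {X : Type*} [MeasurableSpace X]
    {k : ℕ} {A : Set (Fin k → ℝ)} {D : X → Set A} (hD : IsMeasurableCompactValued D) :
    ∃ f : X → A, Measurable f ∧ ∀ x, f x ∈ D x := by
  have H : ∀ I : Finset (Fin k), ∃ E : X → Set A, IsMeasurableCompactValued E ∧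
      (∀ x, E x ⊆ D x) ∧ ∀ i ∈ I, ∀ x, ∀ a ∈ E x, ∀ b ∈ E x, (a : Fin k → ℝ) i = b.1 i := by
    intro I
    induction I using Finset.induction_on with
    | empty => exact ⟨D, hD, fun _ => subset_rfl, by simp⟩
    | insert i I _ ih =>
      obtain ⟨E, hE, hsub, heq⟩ := ih
      have hc : Continuous fun a : A => (a : Fin k → ℝ) i :=
        (continuous_apply i).comp continuous_subtype_val
      refine ⟨_, hE.argmin hc, fun x a ha => hsub x ha.1, fun j hj x a ha b hb => ?_⟩
      rcases Finset.mem_insert.1 hj with rfl | hj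
      · exact le_antisymm (ha.2 b hb.1) (hb.2 a ha.1)
      · exact heq j hj x a ha.1 b hb.1
  obtain ⟨E, hE, hsub, heq⟩ := H Finset.univ
  choose f hf using hE.nonempty
  refine ⟨f, measurable_of_isClosed fun F hF => ?_, fun x => hsub x (hf x)⟩
  -- With every coordinate fixed, `E x` is a singleton, so the preimage of `F` under any selection
  -- is the lower inverse of `F`.
  convert! hE.measurableSet F hF using 1
  ext x
  refine ⟨fun h => ⟨f x, hf x, h⟩, fun ⟨a, ha, haF⟩ => ?_⟩
  have : f x = a := Subtype.ext (funext fun i => heq i (Finset.mem_univ i) x _ (hf x) _ ha)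
  rwa [mem_preimage, this]

namespace DynProg

variable {n k : ℕ} {S : Set (Fin n → ℝ)} {A : Set (Fin k → ℝ)} {P : DynProg S A}

/-- Projection along compact fibres: if `{s} × Γ(s)` misses `K`, the tube lemma gives an open box
missing `K`, and upper hemicontinuity keeps nearby `Γ(s')` inside it. -/
theorem UscAssumptions.isClosed_setOf_exists_mem (hP : P.UscAssumptions) {K : Set (S × A)}
    (hK : IsClosed K) : IsClosed {s | ∃ a ∈ P.Γ s, (s, a) ∈ K} := by
  rw [← isOpen_compl_iff, isOpen_iff_forall_mem_open]
  intro s hs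
  have hsub : ({s} : Set S) ×ˢ P.Γ s ⊆ Kᶜ := by
    rintro ⟨s', a⟩ ⟨rfl, ha⟩ hmem
    exact hs ⟨a, ha, hmem⟩
  obtain ⟨U, V, hU, hV, hsU, hΓV, hUV⟩ :=
    generalized_tube_lemma isCompact_singleton (hP.compact_Γ s) hK.isOpen_compl hsub
  refine ⟨U ∩ {s | P.Γ s ⊆ V}, ?_, hU.inter (hP.usc_Γ V hV), hsU rfl, hΓV⟩
  rintro s' ⟨hs'U, hs'V⟩ ⟨a, ha, hmem⟩
  exact hUV (mk_mem_prod hs'U (hs'V ha)) hmem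

theorem UscAssumptions.exists_isMaxOn (hP : P.UscAssumptions) {h : S × A → ℝ}
    (hh : UpperSemicontinuous h) (s : S) {F : Set A} (hF : IsClosed F)
    (hne : (P.Γ s ∩ F).Nonempty) :
    ∃ a ∈ P.Γ s ∩ F, ∀ b ∈ P.Γ s ∩ F, h (s, b) ≤ h (s, a) := by
  have hc : Continuous fun a : A => (s, a) := by fun_prop
  obtain ⟨a, ha, hm⟩ := UpperSemicontinuousOn.exists_isMaxOn hne
    ((hP.compact_Γ s).inter_right hF) ((hh.comp hc).upperSemicontinuousOn _)
  exact ⟨a, ha, fun b hb => hm hb⟩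

/-- A measurable function that is attained from above by an u.s.c. objective has a measurable
selection attaining it. -/
theorem UscAssumptions.exists_policy_ge (hP : P.UscAssumptions) {h : S × A → ℝ}
    (hh : UpperSemicontinuous h) {W : S → ℝ} (hW : Measurable W)
    (hWh : ∀ s, ∃ a ∈ P.Γ s, W s ≤ h (s, a)) :
    ∃ l : P.Policy, ∀ s, W s ≤ h (s, l.toFun s) := by
  have hD : IsMeasurableCompactValued fun s => {a ∈ P.Γ s | W s ≤ h (s, a)} := by
    refine ⟨hWh, fun s => ?_, fun F hF => ?_⟩
    · have hc : Continuous fun a : A => (s, a) := by fun_prop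
      exact (hP.compact_Γ s).inter_right ((hh.comp hc).isClosed_preimage (W s))
    -- The maximum of `h (s, ·)` over `P.Γ s ∩ F` is attained, so it reaches `W s` as soon as it
    -- reaches every rational `q ≤ W s`.
    · have key : {s | ({a ∈ P.Γ s | W s ≤ h (s, a)} ∩ F).Nonempty} =
          ⋂ q : ℚ, {s | (q : ℝ) ≤ W s}ᶜ ∪
            {s | ∃ a ∈ P.Γ s, (s, a) ∈ Prod.snd ⁻¹' F ∩ h ⁻¹' Ici (q : ℝ)} := by
        ext s
        simp only [mem_ofPred_eq, mem_iInter, mem_union, mem_compl_iff]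
        constructor
        · rintro ⟨a, ⟨ha, haW⟩, haF⟩ q
          by_cases hq : (q : ℝ) ≤ W s
          · exact Or.inr ⟨a, ha, haF, hq.trans haW⟩
          · exact Or.inl hq
        · intro H
          have hq : ∀ q : ℚ, (q : ℝ) ≤ W s → ∃ a ∈ P.Γ s, a ∈ F ∧ (q : ℝ) ≤ h (s, a) :=
            fun q hq => (H q).resolve_left fun hn => hn hq
          obtain ⟨q₀, hq₀⟩ := exists_rat_lt (W s)
          obtain ⟨c, hc, hcF, -⟩ := hq q₀ hq₀.le
          obtain ⟨a, ha, hm⟩ := hP.exists_isMaxOn hh s hF ⟨c, hc, hcF⟩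
          refine ⟨a, ⟨ha.1, ?_⟩, ha.2⟩
          by_contra! hlt
          obtain ⟨q, hq1, hq2⟩ := exists_rat_btwn hlt
          obtain ⟨d, hd, hdF, hdq⟩ := hq q hq2.le
          linarith [hm d ⟨hd, hdF⟩]
      rw [key]
      exact MeasurableSet.iInter fun q => (measurableSet_le measurable_const hW).compl.union
        (hP.isClosed_setOf_exists_mem
          ((hF.preimage continuous_snd).inter (hh.isClosed_preimage _))).measurableSet
  obtain ⟨f, hf, hmem⟩ := hD.exists_measurable_selection
  exact ⟨⟨f, hf, fun s => (hmem s).1⟩, fun s => (hmem s).2⟩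

end DynProg

/-! ### Bounded functions and uniform limits -/

theorem BddFun.exists_nonneg {X : Type*} {f : X → ℝ} (hf : BddFun f) :
    ∃ M : ℝ, 0 ≤ M ∧ ∀ x, |f x| ≤ M :=
  let ⟨M, hM⟩ := hf
  ⟨max M 0, le_max_right _ _, fun x => (hM x).trans (le_max_left _ _)⟩

theorem BddFun.integrable {X : Type*} [MeasurableSpace X] {μ : Measure X} [IsFiniteMeasure μ]
    {f : X → ℝ} (hf : BddFun f) (hm : Measurable f) : Integrable f μ :=
  let ⟨M, hM⟩ := hf
  Integrable.of_bound hm.aestronglyMeasurable M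
    (Filter.Eventually.of_forall fun x => (Real.norm_eq_abs (f x)).trans_le (hM x))

theorem abs_integral_le_of_forall_abs_le {X : Type*} [MeasurableSpace X] {μ : Measure X}
    [IsProbabilityMeasure μ] {f : X → ℝ} {M : ℝ} (hM : ∀ x, |f x| ≤ M) : |∫ x, f x ∂μ| ≤ M := by
  simpa using norm_integral_le_of_norm_le_const (μ := μ)
    (Filter.Eventually.of_forall fun x => (Real.norm_eq_abs (f x)).trans_le (hM x))

theorem upperSemicontinuous_of_uniform_approx {X : Type*} [TopologicalSpace X] {f : X → ℝ}
    (h : ∀ ε > 0, ∃ g : X → ℝ, UpperSemicontinuous g ∧ ∀ x, |g x - f x| ≤ ε) :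
    UpperSemicontinuous f := by
  intro x c hc
  -- One third of the gap for the error at `x`, one for the error at `y`, one for the semicontinuity
  -- of `g`.
  obtain ⟨g, hg, hgf⟩ := h ((c - f x) / 3) (by linarith)
  have hx := abs_le.1 (hgf x)
  filter_upwards [hg x (c - (c - f x) / 3) (by linarith)] with y hy
  have := abs_le.1 (hgf y)
  linarith

/-! ### The Bellman operator and value iteration -/

namespace DynProg

variable {n k : ℕ} {S : Set (Fin n → ℝ)} {A : Set (Fin k → ℝ)} {P : DynProg S A}

/-- The payoff of an action followed by the continuation value `f`. -/
noncomputable def objective (P : DynProg S A) (f : S → ℝ) (x : S × A) : ℝ :=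
  P.r x + P.β * ∫ s', f s' ∂(P.p x)

/-- The Bellman operator. -/
noncomputable def bellman (P : DynProg S A) (f : S → ℝ) (s : S) : ℝ :=
  sSup ((fun a => P.objective f (s, a)) '' P.Γ s)

theorem upperSemicontinuous_objective (hP : P.UscAssumptions) {f : S → ℝ}
    (hf : UpperSemicontinuous f) (hb : BddFun f) : UpperSemicontinuous (P.objective f) :=
  hP.usc_r.add ((continuous_const.mul continuous_id).comp_upperSemicontinuous (hP.usc_p f hf hb).1
    fun _ _ h => mul_le_mul_of_nonneg_left h P.β_pos.le)

theorem bddFun_objective (hr : BddFun P.r) {f : S → ℝ} (hb : BddFun f) :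
    BddFun (P.objective f) := by
  obtain ⟨R, hR⟩ := hr
  obtain ⟨M, hM⟩ := hb
  refine ⟨R + P.β * M, fun x => (abs_add_le _ _).trans (add_le_add (hR x) ?_)⟩
  rw [abs_mul, abs_of_pos P.β_pos]
  exact mul_le_mul_of_nonneg_left (abs_integral_le_of_forall_abs_le hM) P.β_pos.le

theorem measurable_objective {f : S → ℝ} (hf : Measurable f) : Measurable (P.objective f) :=
  P.measurable_r.add (measurable_const.mul
    hf.stronglyMeasurable.integral_kernel.measurable)

theorem exists_objective_eq_bellman (hP : P.UscAssumptions) {f : S → ℝ}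
    (hf : UpperSemicontinuous f) (hb : BddFun f) (s : S) :
    ∃ a ∈ P.Γ s, P.objective f (s, a) = P.bellman f s := by
  obtain ⟨a, ⟨ha, -⟩, hm⟩ := hP.exists_isMaxOn (upperSemicontinuous_objective hP hf hb) s
    isClosed_univ (by simpa using hP.nonempty_Γ s)
  have hg : IsGreatest ((fun a => P.objective f (s, a)) '' P.Γ s) (P.objective f (s, a)) :=
    ⟨⟨a, ha, rfl⟩, forall_mem_image.2 fun b hb => hm b ⟨hb, trivial⟩⟩
  exact ⟨a, ha, hg.csSup_eq.symm⟩

theorem objective_le_bellman (hP : P.UscAssumptions) {f : S → ℝ} (hb : BddFun f) {s : S} {a : A}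
    (ha : a ∈ P.Γ s) : P.objective f (s, a) ≤ P.bellman f s := by
  obtain ⟨M, hM⟩ := bddFun_objective hP.bdd_r hb
  refine le_csSup ⟨M, ?_⟩ ⟨a, ha, rfl⟩
  rintro _ ⟨b, -, rfl⟩
  exact (abs_le.1 (hM _)).2

theorem upperSemicontinuous_bellman (hP : P.UscAssumptions) {f : S → ℝ}
    (hf : UpperSemicontinuous f) (hb : BddFun f) : UpperSemicontinuous (P.bellman f) := by
  rw [upperSemicontinuous_iff_isClosed_preimage]
  intro c
  convert! hP.isClosed_setOf_exists_mem
    ((upperSemicontinuous_objective hP hf hb).isClosed_preimage c) using 1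
  ext s
  constructor
  · intro h
    obtain ⟨a, ha, he⟩ := exists_objective_eq_bellman hP hf hb s
    exact ⟨a, ha, le_of_le_of_eq h he.symm⟩
  · rintro ⟨a, ha, h⟩
    exact le_trans h (objective_le_bellman hP hb ha)

theorem bddFun_bellman (hP : P.UscAssumptions) {f : S → ℝ}
    (hf : UpperSemicontinuous f) (hb : BddFun f) : BddFun (P.bellman f) := by
  obtain ⟨M, hM⟩ := bddFun_objective hP.bdd_r hb
  refine ⟨M, fun s => ?_⟩
  obtain ⟨a, -, he⟩ := exists_objective_eq_bellman hP hf hb s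
  exact he ▸ hM _

/-- A maximizer for `f` is also feasible for `g`, and integrating against a probability measure does
not enlarge the distance `δ`. -/
theorem bellman_sub_le (hP : P.UscAssumptions) {f g : S → ℝ}
    (hf : UpperSemicontinuous f) (hfb : BddFun f) (hg : UpperSemicontinuous g) (hgb : BddFun g)
    {δ : ℝ} (h : ∀ s, |f s - g s| ≤ δ) (s : S) :
    P.bellman f s - P.bellman g s ≤ P.β * δ := by
  obtain ⟨a, ha, he⟩ := exists_objective_eq_bellman hP hf hfb s
  have h1 := objective_le_bellman hP hgb ha
  have h2 : ∫ s', f s' ∂(P.p (s, a)) - ∫ s', g s' ∂(P.p (s, a)) ≤ δ := by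
    rw [← integral_sub (hfb.integrable hf.measurable) (hgb.integrable hg.measurable)]
    exact (abs_le.1 (abs_integral_le_of_forall_abs_le h)).2
  have h3 := mul_le_mul_of_nonneg_left h2 P.β_pos.le
  rw [← he]
  unfold objective at h1 ⊢
  linarith

theorem abs_bellman_sub_le (hP : P.UscAssumptions) {f g : S → ℝ}
    (hf : UpperSemicontinuous f) (hfb : BddFun f) (hg : UpperSemicontinuous g) (hgb : BddFun g)
    {δ : ℝ} (h : ∀ s, |f s - g s| ≤ δ) (s : S) :
    |P.bellman f s - P.bellman g s| ≤ P.β * δ :=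
  abs_sub_le_iff.2 ⟨bellman_sub_le hP hf hfb hg hgb h s,
    bellman_sub_le hP hg hgb hf hfb (fun s => abs_sub_comm (f s) (g s) ▸ h s) s⟩

/-- Value iteration converges to a bounded u.s.c. solution of the Bellman equation. -/
theorem exists_bellman_fixedPoint (hP : P.UscAssumptions) :
    ∃ W : S → ℝ, UpperSemicontinuous W ∧ BddFun W ∧ P.bellman W = W ∧
      ∀ s, Filter.Tendsto (fun m => (P.bellman^[m] fun _ => 0) s) Filter.atTop (nhds (W s)) := by
  set v : ℕ → S → ℝ := fun m => P.bellman^[m] fun _ => 0 with hv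
  have hsucc : ∀ m, v (m + 1) = P.bellman (v m) := fun m => Function.iterate_succ_apply' _ _ _
  have hvu : ∀ m, UpperSemicontinuous (v m) ∧ BddFun (v m) := by
    intro m
    induction m with
    | zero => exact ⟨upperSemicontinuous_const, 0, fun x => by simp [hv]⟩
    | succ m ih =>
      rw [hsucc]
      exact ⟨upperSemicontinuous_bellman hP ih.1 ih.2, bddFun_bellman hP ih.1 ih.2⟩
  obtain ⟨C, hC0, hC⟩ := (hvu 1).2.exists_nonneg
  have hgeom : ∀ m s, |v m s - v (m + 1) s| ≤ C * P.β ^ m := by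
    intro m
    induction m with
    | zero => intro s; simpa [hv] using hC s
    | succ m ih =>
      intro s
      rw [hsucc (m + 1), hsucc m, pow_succ']
      have := abs_bellman_sub_le hP (hvu m).1 (hvu m).2 (hvu (m + 1)).1 (hvu (m + 1)).2 ih s
      rw [hsucc m] at this
      linarith
  have hlim : ∀ s, ∃ w, Filter.Tendsto (fun m => v m s) Filter.atTop (nhds w) := fun s =>
    cauchySeq_tendsto_of_complete
      (cauchySeq_of_le_geometric P.β C P.β_lt_one fun m => hgeom m s)
  choose W hW using hlim
  have hdist : ∀ m s, |v m s - W s| ≤ C * P.β ^ m / (1 - P.β) := fun m s =>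
    dist_le_of_le_geometric_of_tendsto P.β C P.β_lt_one (fun m => hgeom m s) (hW s) m
  have htend : Filter.Tendsto (fun m => C * P.β ^ m / (1 - P.β)) Filter.atTop (nhds 0) := by
    simpa using ((tendsto_pow_atTop_nhds_zero_of_lt_one P.β_pos.le P.β_lt_one).const_mul
      C).div_const (1 - P.β)
  have hWu : UpperSemicontinuous W := upperSemicontinuous_of_uniform_approx fun ε hε => by
    obtain ⟨m, hm⟩ := (htend.eventually (gt_mem_nhds hε)).exists
    exact ⟨v m, (hvu m).1, fun s => (hdist m s).trans hm.le⟩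
  have hWb : BddFun W := ⟨C / (1 - P.β), fun s => by simpa [hv] using hdist 0 s⟩
  refine ⟨W, hWu, hWb, funext fun s => ?_, hW⟩
  -- The shifted iterates tend to `W s`, and by the contraction estimate also to `P.bellman W s`.
  refine tendsto_nhds_unique (f := fun m => v (m + 1) s) ?_
    ((hW s).comp (Filter.tendsto_add_atTop_nat 1))
  rw [tendsto_iff_dist_tendsto_zero]
  refine squeeze_zero (fun _ => dist_nonneg) (fun m => ?_) (by simpa using htend.const_mul P.β)
  rw [hsucc]
  exact abs_bellman_sub_le hP (hvu m).1 (hvu m).2 hWu hWb (hdist m) s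

/-- Induction principle for the limit of value iteration. -/
theorem valueIteration_induction (hP : P.UscAssumptions) {Q : (S → ℝ) → Prop}
    (h0 : Q fun _ => 0)
    (hsucc : ∀ f, UpperSemicontinuous f → BddFun f → Q f → Q (P.bellman f)) (m : ℕ) :
    Q (P.bellman^[m] fun _ => 0) := by
  have H : UpperSemicontinuous (P.bellman^[m] fun _ => 0) ∧ BddFun (P.bellman^[m] fun _ => 0) ∧
      Q (P.bellman^[m] fun _ => 0) := by
    induction m with
    | zero => exact ⟨upperSemicontinuous_const, ⟨0, fun x => by simp⟩, h0⟩
    | succ m ih =>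
      rw [Function.iterate_succ_apply']
      exact ⟨upperSemicontinuous_bellman hP ih.1 ih.2.1, bddFun_bellman hP ih.1 ih.2.1,
        hsucc _ ih.1 ih.2.1 ih.2.2⟩
  exact H.2.2

/-! ### Preservation of monotonicity and concavity -/

theorem monotone_bellman (hP : P.UscAssumptions) (hr : P.IncreasingInState P.r)
    (hp : P.KernelIncreasingInState) (hΓ : ∀ s₁ s₂ : S, s₁ ≤ s₂ → P.Γ s₁ ⊆ P.Γ s₂) {f : S → ℝ}
    (hf : UpperSemicontinuous f) (hb : BddFun f) (hmono : Monotone f) :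
    Monotone (P.bellman f) := by
  intro s₁ s₂ hs
  obtain ⟨a, ha, he⟩ := exists_objective_eq_bellman hP hf hb s₁
  have ha₂ := hΓ s₁ s₂ hs ha
  rw [← he]
  exact (add_le_add (hr s₁ s₂ a hs ha ha₂) (mul_le_mul_of_nonneg_left
    (hp f hf.measurable hb hmono s₁ s₂ a hs ha ha₂) P.β_pos.le)).trans
    (objective_le_bellman hP hb ha₂)

theorem jointlyConcave_objective (hp : P.KernelConcave) (hr : P.JointlyConcave P.r) {f : S → ℝ}
    (hf : Measurable f) (hb : BddFun f) (hc : ConcaveState f) :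
    P.JointlyConcave (P.objective f) := by
  intro x hx y hy z hz t ht0 ht1 he
  have h1 := hr x hx y hy z hz t ht0 ht1 he
  have h2 := mul_le_mul_of_nonneg_left (hp f hf hb hc x hx y hy z hz t ht0 ht1 he) P.β_pos.le
  unfold objective
  linarith

/-- The convex combination of maximizers at the two endpoints is feasible at the intermediate state,
where the jointly concave objective bounds the maximum from below. -/
theorem concaveState_bellman (hP : P.UscAssumptions) (hp : P.KernelConcave)
    (hr : P.JointlyConcave P.r) (hΓ : P.ConvexCorrespondence) {f : S → ℝ}
    (hf : UpperSemicontinuous f) (hb : BddFun f) (hc : ConcaveState f) :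
    ConcaveState (P.bellman f) := by
  intro s₁ _ s₂ _ s _ t ht0 ht1 he
  obtain ⟨a₁, ha₁, he₁⟩ := exists_objective_eq_bellman hP hf hb s₁
  obtain ⟨a₂, ha₂, he₂⟩ := exists_objective_eq_bellman hP hf hb s₂
  obtain ⟨a, ha, hea⟩ := hΓ s₁ s₂ s a₁ a₂ t ha₁ ha₂ ht0 ht1 he
  rw [← he₁, ← he₂]
  exact (jointlyConcave_objective hp hr hf.measurable hb hc (s₁, a₁) ha₁ (s₂, a₂) ha₂ (s, a) ha
    t ht0 ht1 (Prod.ext he hea)).trans (objective_le_bellman hP hb ha)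

end DynProg

/-! ### The law of the state-action process -/

namespace DynProg

variable {n k : ℕ} {S : Set (Fin n → ℝ)} {A : Set (Fin k → ℝ)} {P : DynProg S A}

instance (σ : P.Strategy) (s : S) : IsProbabilityMeasure (P.law σ s) := by
  unfold law
  infer_instance

theorem integral_law_zero (σ : P.Strategy) (s : S) {g : S × A → ℝ} (hg : Measurable g) :
    ∫ ω, g (ω 0) ∂(P.law σ s) = g (s, σ.act 0 (fun i => i.elim0, s)) := by
  have hmap := Kernel.traj_map_frestrictLe_apply (X := fun _ => S × A) (κ := P.stepKernel σ) 0 0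
    (fun _ => (s, σ.act 0 (fun i => i.elim0, s)))
  have hm : Measurable fun x : (i : Finset.Iic 0) → S × A => g (x ⟨0, Finset.mem_Iic.2 le_rfl⟩) :=
    hg.comp (measurable_pi_apply _)
  have h := integral_map (μ := P.law σ s)
    (Preorder.measurable_frestrictLe (X := fun _ => S × A) 0).aemeasurable
    hm.aestronglyMeasurable
  rw [law, hmap, Kernel.partialTraj_self, Kernel.id_apply,
    integral_dirac' _ _ hm.stronglyMeasurable] at h
  exact h.symm

theorem integral_stepKernel (σ : P.Strategy) (t : ℕ) (x : (i : Finset.Iic t) → S × A)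
    {g : S × A → ℝ} (hg : Measurable g) (hb : BddFun g) :
    ∫ y, g y ∂(P.stepKernel σ t x) = ∫ s', g (s', σ.act (t + 1) (toHist S A t (x, s')))
      ∂(P.p (x ⟨t, Finset.mem_Iic.2 le_rfl⟩)) := by
  have hint : Integrable g (P.stepKernel σ t x) := hb.integrable hg
  unfold stepKernel at hint ⊢
  rw [ProbabilityTheory.integral_compProd hint, Kernel.comap_apply]
  congr 1
  ext s'
  exact Kernel.integral_deterministic'
    (f := fun y => g (s', y)) (a := (x, s'))
    (g := fun x : ((i : Finset.Iic t) → S × A) × S => σ.act (t + 1) (toHist S A t x))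
    ((σ.measurable_act (t + 1)).comp (measurable_toHist S A t))
    (hg.comp measurable_prodMk_left).stronglyMeasurable

theorem integral_law_succ (σ : P.Strategy) (s : S) (t : ℕ) {g : S × A → ℝ} (hg : Measurable g)
    (hb : BddFun g) :
    ∫ ω, g (ω (t + 1)) ∂(P.law σ s) =
      ∫ ω, ∫ s', g (s', σ.act (t + 1) (toHist S A t (Preorder.frestrictLe t ω, s')))
        ∂(P.p (ω t)) ∂(P.law σ s) := by
  have hprod := Kernel.partialTraj_compProd_eq_map_traj (X := fun _ => S × A)
    (κ := P.stepKernel σ) (Nat.zero_le t) (x₀ := fun _ => (s, σ.act 0 (fun i => i.elim0, s)))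
  have hmeas : Measurable fun ω : ℕ → S × A =>
      (Preorder.frestrictLe (π := fun _ => S × A) t ω, ω (t + 1)) := by fun_prop
  have hm : Measurable fun y : ((i : Finset.Iic t) → S × A) × (S × A) => g y.2 :=
    hg.comp measurable_snd
  have h1 := integral_map (μ := P.law σ s) hmeas.aemeasurable hm.aestronglyMeasurable
  have hint : BddFun fun y : ((i : Finset.Iic t) → S × A) × (S × A) => g y.2 :=
    hb.imp fun M hM y => hM y.2
  rw [law, ← hprod, Measure.integral_compProd (hint.integrable hm)] at h1
  have hm2 : Measurable fun x : (i : Finset.Iic t) → S × A => ∫ y, g y ∂(P.stepKernel σ t x) :=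
    hg.stronglyMeasurable.integral_kernel.measurable
  have h2 := integral_map (μ := P.law σ s)
    (Preorder.measurable_frestrictLe (X := fun _ => S × A) t).aemeasurable
    hm2.aestronglyMeasurable
  rw [law, Kernel.traj_map_frestrictLe_apply] at h2
  rw [law]
  refine h1.symm.trans (h2.trans (integral_congr_ae (Filter.Eventually.of_forall fun ω => ?_)))
  exact integral_stepKernel σ t _ hg hb

/-- Strategies only play feasible actions. Writing the last action as a function of the history
makes the comparison pointwise and avoids measurability of the graph. -/
theorem integral_law_mono (σ : P.Strategy) (s : S) (t : ℕ) {g h : S × A → ℝ} (hg : Measurable g)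
    (hgb : BddFun g) (hh : Measurable h) (hhb : BddFun h) (hle : ∀ x ∈ P.graph, g x ≤ h x) :
    ∫ ω, g (ω t) ∂(P.law σ s) ≤ ∫ ω, h (ω t) ∂(P.law σ s) := by
  cases t with
  | zero =>
    rw [integral_law_zero σ s hg, integral_law_zero σ s hh]
    exact hle _ (σ.feasible 0 (_, s))
  | succ t =>
    -- Measurability in `ω` is immediate for the step-kernel integral; `eg` and `eh` then carry
    -- integrability over to the explicit form.
    have aux : ∀ {f : S × A → ℝ}, Measurable f → BddFun f → Integrable
        (fun ω : ℕ → S × A => ∫ y, f y ∂(P.stepKernel σ t (Preorder.frestrictLe t ω)))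
        (P.law σ s) := fun {f} hf hb =>
      BddFun.integrable (hb.imp fun M hM ω => abs_integral_le_of_forall_abs_le hM)
        (hf.stronglyMeasurable.integral_kernel.measurable.comp (by fun_prop))
    rw [integral_law_succ σ s t hg hgb, integral_law_succ σ s t hh hhb]
    have eg := fun x => integral_stepKernel σ t x hg hgb
    have eh := fun x => integral_stepKernel σ t x hh hhb
    have ig := aux hg hgb
    have ih := aux hh hhb
    simp only [eg, eh] at ig ih
    refine integral_mono ig ih fun ω => ?_
    have hact : Measurable fun s' : S =>
        (s', σ.act (t + 1) (toHist S A t (Preorder.frestrictLe t ω, s'))) :=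
      measurable_id.prodMk (((σ.measurable_act _).comp (measurable_toHist S A t)).comp
        measurable_prodMk_left)
    exact integral_mono (BddFun.integrable (hgb.imp fun M hM _ => hM _) (hg.comp hact))
      (BddFun.integrable (hhb.imp fun M hM _ => hM _) (hh.comp hact))
      fun s' => hle _ (σ.feasible (t + 1) (toHist S A t (_, s')))

theorem integral_law_policy (l : P.Policy) (s : S) (t : ℕ) {g h : S × A → ℝ} (hg : Measurable g)
    (hgb : BddFun g) (hh : Measurable h) (hhb : BddFun h)
    (heq : ∀ s', g (s', l.toFun s') = h (s', l.toFun s')) :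
    ∫ ω, g (ω t) ∂(P.law l.toStrategy s) = ∫ ω, h (ω t) ∂(P.law l.toStrategy s) := by
  cases t with
  | zero =>
    rw [integral_law_zero _ s hg, integral_law_zero _ s hh]
    exact heq s
  | succ t =>
    rw [integral_law_succ _ s t hg hgb, integral_law_succ _ s t hh hhb]
    simp only [Policy.toStrategy, toHist, heq]

/-! ### Verification: the value function solves the Bellman equation -/

theorem hasSum_payoff (hr : BddFun P.r) (σ : P.Strategy) (s : S) :
    HasSum (fun t => P.β ^ t * ∫ ω, P.r (ω t) ∂(P.law σ s)) (P.payoff σ s) := by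
  obtain ⟨M, hM⟩ := hr
  have hint : ∀ t, Integrable (fun ω : ℕ → S × A => P.β ^ t * P.r (ω t)) (P.law σ s) := fun t =>
    (BddFun.integrable ⟨M, fun ω => hM _⟩
      (P.measurable_r.comp (measurable_pi_apply t))).const_mul _
  have hsum : Summable fun t => ∫ ω, ‖P.β ^ t * P.r (ω t)‖ ∂(P.law σ s) := by
    refine Summable.of_nonneg_of_le (fun t => integral_nonneg fun ω => norm_nonneg _) (fun t => ?_)
      ((summable_geometric_of_lt_one P.β_pos.le P.β_lt_one).mul_right M)
    refine (le_abs_self _).trans (abs_integral_le_of_forall_abs_le fun ω => ?_)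
    rw [abs_norm, Real.norm_eq_abs, abs_mul, abs_of_pos (pow_pos P.β_pos t)]
    exact mul_le_mul_of_nonneg_left (hM _) (pow_pos P.β_pos t).le
  simp_rw [← integral_const_mul]
  exact hasSum_integral_of_summable_integral_norm hint hsum

/-- Since the expected objective at time `t` is the expected reward plus `β` times the expectation
of `W` at time `t + 1`, the `W` terms telescope to `W s`. No Bellman equation is needed. -/
theorem hasSum_value_sub_payoff (hr : BddFun P.r) (σ : P.Strategy) (s : S) {W : S → ℝ}
    (hW : Measurable W) (hb : BddFun W) :
    HasSum (fun t => P.β ^ t * (∫ ω, W (ω t).1 ∂(P.law σ s) -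
      ∫ ω, P.objective W (ω t) ∂(P.law σ s))) (W s - P.payoff σ s) := by
  set w : ℕ → ℝ := fun t => ∫ ω, W (ω t).1 ∂(P.law σ s) with hw
  have hb' : BddFun fun x : S × A => W x.1 := hb.imp fun M hM x => hM x.1
  have hobj : ∀ t, ∫ ω, P.objective W (ω t) ∂(P.law σ s) =
      ∫ ω, P.r (ω t) ∂(P.law σ s) + P.β * w (t + 1) := by
    intro t
    have h1 := integral_law_succ σ s t (hW.comp measurable_fst) hb'
    have hEm : Measurable fun x : S × A => ∫ s', W s' ∂(P.p x) :=
      hW.stronglyMeasurable.integral_kernel.measurable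
    have hEb : BddFun fun x : S × A => ∫ s', W s' ∂(P.p x) :=
      hb.imp fun M hM x => abs_integral_le_of_forall_abs_le hM
    simp only [Function.comp_def] at h1
    unfold objective
    simp only [hw]
    rw [h1, integral_add, integral_const_mul]
    · exact BddFun.integrable (hr.imp fun M hM _ => hM _)
        (P.measurable_r.comp (measurable_pi_apply t))
    · exact (BddFun.integrable (hEb.imp fun M hM _ => hM _)
        (hEm.comp (measurable_pi_apply t))).const_mul _
  have hw0 : w 0 = W s := integral_law_zero σ s (hW.comp measurable_fst)
  obtain ⟨M, hM⟩ := hb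
  have hsum : Summable fun t => P.β ^ t * w t := by
    refine Summable.of_norm_bounded
      ((summable_geometric_of_lt_one P.β_pos.le P.β_lt_one).mul_right M) fun t => ?_
    rw [Real.norm_eq_abs, abs_mul, abs_of_pos (pow_pos P.β_pos t)]
    exact mul_le_mul_of_nonneg_left (abs_integral_le_of_forall_abs_le fun ω => hM _)
      (pow_pos P.β_pos t).le
  -- The series of `β ^ t * w t` minus its shift by one leaves `w 0 = W s`.
  have H := (hsum.hasSum.sub ((hasSum_nat_add_iff' 1).2 hsum.hasSum)).sub
    (hasSum_payoff hr σ s)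
  convert! H using 1
  · ext t
    rw [hobj, pow_succ]
    ring
  · simp [hw0]

theorem expected_objective_le (hP : P.UscAssumptions) {W : S → ℝ} (hW : UpperSemicontinuous W)
    (hb : BddFun W) (hfix : P.bellman W = W) (σ : P.Strategy) (s : S) (t : ℕ) :
    ∫ ω, P.objective W (ω t) ∂(P.law σ s) ≤ ∫ ω, W (ω t).1 ∂(P.law σ s) :=
  integral_law_mono σ s t (measurable_objective hW.measurable) (bddFun_objective hP.bdd_r hb)
    (hW.measurable.comp measurable_fst) (hb.imp fun _ hM x => hM x.1) fun x hx =>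
      (objective_le_bellman hP hb hx).trans_eq (congrFun hfix x.1)

/-- The payoff of a strategy is at most that of its first action followed by the solution of the
Bellman equation. -/
theorem payoff_le_objective (hP : P.UscAssumptions) {W : S → ℝ} (hW : UpperSemicontinuous W)
    (hb : BddFun W) (hfix : P.bellman W = W) (σ : P.Strategy) (s : S) :
    P.payoff σ s ≤ P.objective W (s, σ.act 0 (fun i => i.elim0, s)) := by
  -- All gaps are nonnegative, so the total dominates the one at time `0`.
  have h := le_hasSum (hasSum_value_sub_payoff hP.bdd_r σ s hW.measurable hb) 0 fun t _ =>
    mul_nonneg (pow_pos P.β_pos t).le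
      (sub_nonneg.2 (expected_objective_le hP hW hb hfix σ s t))
  have h0 : ∫ ω, W (ω 0).1 ∂(P.law σ s) = W s :=
    integral_law_zero σ s (hW.measurable.comp measurable_fst)
  rw [integral_law_zero σ s (measurable_objective hW.measurable), h0] at h
  simp only [pow_zero, one_mul] at h
  linarith

theorem payoff_policy_eq (hr : BddFun P.r) {W : S → ℝ} (hW : Measurable W) (hb : BddFun W)
    (l : P.Policy) (hl : ∀ s, W s = P.objective W (s, l.toFun s)) (s : S) :
    P.payoff l.toStrategy s = W s := by
  have h := hasSum_value_sub_payoff hr l.toStrategy s hW hb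
  have h0 : ∀ t, P.β ^ t * (∫ ω, W (ω t).1 ∂(P.law l.toStrategy s) -
      ∫ ω, P.objective W (ω t) ∂(P.law l.toStrategy s)) = 0 := fun t => by
    rw [← integral_law_policy l s t (hW.comp measurable_fst) (hb.imp fun _ hM x => hM x.1)
      (measurable_objective hW) (bddFun_objective hr hb) hl, Function.comp_def, sub_self, mul_zero]
  simp only [h0] at h
  linarith [h.unique hasSum_zero]

/-- The value function solves the Bellman equation, and a stationary optimal policy exists. -/
theorem value_eq_of_bellman_eq (hP : P.UscAssumptions) {W : S → ℝ} (hW : UpperSemicontinuous W)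
    (hb : BddFun W) (hfix : P.bellman W = W) :
    P.value = W ∧ ∃ l : P.Policy, l.toStrategy.IsOptimal := by
  obtain ⟨l, hl⟩ := hP.exists_policy_ge (upperSemicontinuous_objective hP hW hb) hW.measurable
    fun s => by
      obtain ⟨a, ha, he⟩ := exists_objective_eq_bellman hP hW hb s
      exact ⟨a, ha, by rw [he, hfix]⟩
  have hle : ∀ s, ∀ a ∈ P.Γ s, P.objective W (s, a) ≤ W s := fun s a ha =>
    (objective_le_bellman hP hb ha).trans_eq (congrFun hfix s)
  have hpay := payoff_policy_eq hP.bdd_r hW.measurable hb l fun s =>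
    (hl s).antisymm (hle s _ (l.feasible s))
  have hub : ∀ (σ : P.Strategy) (s : S), P.payoff σ s ≤ W s := fun σ s =>
    (payoff_le_objective hP hW hb hfix σ s).trans (hle s _ (σ.feasible 0 (_, s)))
  have hval : P.value = W := funext fun s => by
    have : Nonempty P.Strategy := ⟨l.toStrategy⟩
    refine le_antisymm (ciSup_le fun σ => hub σ s) ?_
    rw [← hpay s]
    exact le_ciSup (f := fun σ : P.Strategy => P.payoff σ s)
      ⟨W s, forall_mem_range.2 fun σ => hub σ s⟩ l.toStrategy
  exact ⟨hval, l, fun s => by rw [hpay, hval]⟩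

/-- An optimal policy selects maximizers in the Bellman equation. -/
theorem Policy.objective_eq_of_isOptimal (hP : P.UscAssumptions) {W : S → ℝ}
    (hW : UpperSemicontinuous W) (hb : BddFun W) (hfix : P.bellman W = W) {l : P.Policy}
    (hl : l.toStrategy.IsOptimal) (s : S) : P.objective W (s, l.toFun s) = W s := by
  refine ((objective_le_bellman hP hb (l.feasible s)).trans_eq (congrFun hfix s)).antisymm ?_
  rw [← (value_eq_of_bellman_eq hP hW hb hfix).1, ← hl s,
    (value_eq_of_bellman_eq hP hW hb hfix).1]
  exact payoff_le_objective hP hW hb hfix l.toStrategy s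

/-- At the midpoint of distinct maximizers, the strict inequality for `r` and the weak one for the
continuation term push the objective above its maximum `W s`. -/
theorem eq_of_objective_eq (hP : P.UscAssumptions) (hp : P.KernelConcave)
    (hΓ : P.ConvexCorrespondence) (hs : P.StrictConcaveInAction P.r)
    {W : S → ℝ} (hW : UpperSemicontinuous W) (hb : BddFun W) (hfix : P.bellman W = W)
    (hc : ConcaveState W) {s : S} {a b : A} (ha : a ∈ P.Γ s) (hb' : b ∈ P.Γ s)
    (hae : P.objective W (s, a) = W s) (hbe : P.objective W (s, b) = W s) : a = b := by
  by_contra hne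
  have hmid : (s : Fin n → ℝ) = (1 / 2 : ℝ) • (s : Fin n → ℝ) +
      (1 - 1 / 2 : ℝ) • (s : Fin n → ℝ) := by
    rw [← add_smul]
    norm_num
  obtain ⟨c, hc', hce⟩ := hΓ s s s a b (1 / 2) ha hb' (by norm_num) (by norm_num) hmid
  have h1 := hs s a ha b hb' c hc' hne (1 / 2) (by norm_num) (by norm_num) hce
  have h2 := mul_le_mul_of_nonneg_left (hp W hW.measurable hb hc (s, a) ha (s, b) hb' (s, c) hc'
    (1 / 2) (by norm_num) (by norm_num) (Prod.ext hmid hce)) P.β_pos.le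
  have h3 := (objective_le_bellman hP hb hc').trans_eq (congrFun hfix s)
  unfold objective at hae hbe h3
  simp only at h1 h2
  linarith

end DynProg

/-! ### Passage to the limit and conclusion -/

theorem mainTheorem5 {n k : ℕ} {S : Set (Fin n → ℝ)} {A : Set (Fin k → ℝ)}
    (hS : MeasurableSet S) (hA : MeasurableSet A)
    (P : DynProg S A) (hP : P.UscAssumptions) :
    (P.IncreasingInState P.r → P.KernelIncreasingInState →
      (∀ s₁ s₂ : S, s₁ ≤ s₂ → P.Γ s₁ ⊆ P.Γ s₂) →
      Monotone P.value) ∧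
    (P.KernelConcave → P.JointlyConcave P.r → Convex ℝ S → P.ConvexCorrespondence →
      DynProg.ConcaveState P.value ∧
      (P.StrictConcaveInAction P.r → ∃! l : P.Policy, l.toStrategy.IsOptimal)) := by
  obtain ⟨W, hW, hb, hfix, hlim⟩ := DynProg.exists_bellman_fixedPoint hP
  obtain ⟨hval, l, hl⟩ := DynProg.value_eq_of_bellman_eq hP hW hb hfix
  rw [hval]
  refine ⟨fun hr hp hΓ s₁ s₂ hs => ?_, fun hp hr _ hΓ => ?_⟩
  · have hmono := DynProg.valueIteration_induction hP (Q := Monotone) monotone_const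
      fun f hf hfb => DynProg.monotone_bellman hP hr hp hΓ hf hfb
    exact le_of_tendsto_of_tendsto' (hlim s₁) (hlim s₂) fun m => hmono m hs
  · have hconc := DynProg.valueIteration_induction hP (Q := DynProg.ConcaveState)
      (fun _ _ _ _ _ _ _ _ _ _ => by simp)
      fun f hf hfb => DynProg.concaveState_bellman hP hp hr hΓ hf hfb
    have hWc : DynProg.ConcaveState W := fun x hx y hy z hz t ht0 ht1 he =>
      le_of_tendsto_of_tendsto' (((hlim x).const_mul t).add ((hlim y).const_mul (1 - t))) (hlim z)
        fun m => hconc m x hx y hy z hz t ht0 ht1 he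
    refine ⟨hWc, fun hs => ⟨l, hl, fun l' hl' => ?_⟩⟩
    have hfun : l'.toFun = l.toFun := funext fun s =>
      DynProg.eq_of_objective_eq hP hp hΓ hs hW hb hfix hWc (l'.feasible s) (l.feasible s)
        (DynProg.Policy.objective_eq_of_isOptimal hP hW hb hfix hl' s)
        (DynProg.Policy.objective_eq_of_isOptimal hP hW hb hfix hl s)
    cases l
    cases l'
    cases hfun
    rfl
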